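/- Let $(\mu,\theta_1,\theta_2)$ be the coordinates $\xi_1=\sinh\mu\sin\theta_1\cos\theta_2$, $\xi_2=\sinh\mu\sin\theta_1\sin\theta_2$, $\xi_3=\sinh\mu\cos\theta_1$, $\xi_4=\cosh\mu$ on the upper sheet of the hyperboloid $\xi_4^2-\xi_1^2-\xi_2^2-\xi_3^2=1$, and let $V_3=L^2(\nu)$, where $\nu$ is either $d\mu\,d\Omega$ ($\mu\in\mathbb R$) or the Lorentz-invariant measure $\sinh^2\mu\,d\mu\,d\Omega$ ($\mu>0$), with $d\Omega=\sin\theta_1\,d\theta_1d\theta_2$, $0<\theta_1<\pi$, $0<\theta_2<2\pi$. Consider the generators of $iso(3,1)$ on functions of $(\mu,\theta_1,\theta_2)$: $\mathfrak I$ is multiplication by $\cosh\mu$, $P^i$ is multiplication by $\xi_i$, and $$Q^1=i\Big(\sin\theta_1\cos\theta_2\,\partial_\mu+\coth\mu\big(\cos\theta_1\cos\theta_2\,\partial_{\theta_1}-\tfrac{\sin\theta_2}{\sin\theta_1}\partial_{\theta_2}\big)\Big),$$ $$Q^2=i\Big(\sin\theta_1\sin\theta_2\,\partial_\mu+\coth\mu\big(\cos\theta_1\sin\theta_2\,\partial_{\theta_1}+\tfrac{\cos\theta_2}{\sin\theta_1}\partial_{\theta_2}\big)\Big),$$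 $$Q^3=i\big(\cos\theta_1\,\partial_\mu-\coth\mu\sin\theta_1\,\partial_{\theta_1}\big).$$ Put $A_\pm^i=\frac1{\sqrt2}(Q^i\mp iP^i)$ and $\psi_0=N^{-1/2}e^{-\cosh\mu}$, where $N$ is the squared norm of $e^{-\cosh\mu}$ in $V_3$. Let $h=L^2([0,\infty))$ and $H_3=h\otimes V_3=L^2([0,\infty)\times\text{hyperboloid})$. For $\psi\in V_3$ and $g\in h$ write $\psi(g)=g\otimes\psi$. For an operator $B$ on functions on the hyperboloid and a bounded function $f$ on $[0,\infty)$, let $B(f)$ be (multiplication by $f$)$\,\otimes B$, so that $B(f)\psi(g)=(B\psi)(fg)$. Put $B(t)=B(\chi_{[0,t]})$, $dB(t)=B(t+dt)-B(t)$ and $B(dt)=B(\chi_{(t,t+dt]})$, for $t\ge0$ and $dt\ge0$. Then $\psi_0$ is a unit vector of $V_3$, the vectors $dA_\pm^i(t)\psi_0(g)$ and $d\mathfrak I(t)\psi_0(g)$ belong to $H_3$ for all $g\in h$, and the following multiplication rules hold for all $i,j\in\{1,2,3\}$ and all $t,dt\ge0$: $$dA_-^i(t)\,dA_+^j(t)=\delta^{ij}\,\mathfrak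 I(dt),\qquad dA_+^i(t)\,dA_-^j(t)=0,$$ $$dA_-^i(t)\,d\mathfrak I(t)=-d\mathfrak I(t)\,dA_-^i(t)=\tfrac12\big(A_-^i(dt)-A_+^i(dt)\big),$$ and also $-d\mathfrak I(t)\,dA_+^i(t)=\tfrac12\big(A_-^i(dt)-A_+^i(dt)\big)$. Here $X=Y$ is understood for expectations in the state $\psi_0$: for all $f,g\in h$ the vectors $X\psi_0(g)$ and $Y\psi_0(g)$ belong to $H_3$ and $\langle\psi_0(f),X\psi_0(g)\rangle=\langle\psi_0(f),Y\psi_0(g)\rangle$. Moreover, the rules for $dA_-^i\,dA_+^j$, $dA_+^i\,dA_-^j$ and $dA_-^i\,d\mathfrak I$ hold as identities of vectors $X\psi_0(g)=Y\psi_0(g)$ in $H_3$, for every $g\in h$. -/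

import Mathlib

open MeasureTheory Set
open scoped ComplexConjugate

noncomputable section

namespace IsoThreeOne

/-- Coordinates `(μ, θ₁, θ₂)` on the upper sheet `ξ₄² - ξ₁² - ξ₂² - ξ₃² = 1`, `ξ₄ > 0`, of the
hyperboloid; functions on the hyperboloid are written in these coordinates. -/
abbrev Chart : Type := ℝ × ℝ × ℝ

/-- `g₁ = sin θ₁ cos θ₂`, `g₂ = sin θ₁ sin θ₂`, `g₃ = cos θ₁`. -/
def direction : Fin 3 → Chart → ℝ
  | 0, x => Real.sin x.2.1 * Real.cos x.2.2
  | 1, x => Real.sin x.2.1 * Real.sin x.2.2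
  | 2, x => Real.cos x.2.1

/-- `∂ψ/∂μ`. -/
def partialMu (ψ : Chart → ℂ) (x : Chart) : ℂ :=
  deriv (fun m : ℝ => ψ (m, x.2.1, x.2.2)) x.1

/-- `∂ψ/∂θ₁`. -/
def partialTheta1 (ψ : Chart → ℂ) (x : Chart) : ℂ :=
  deriv (fun a : ℝ => ψ (x.1, a, x.2.2)) x.2.1

/-- `∂ψ/∂θ₂`. -/
def partialTheta2 (ψ : Chart → ℂ) (x : Chart) : ℂ :=
  deriv (fun b : ℝ => ψ (x.1, x.2.1, b)) x.2.2

def coth (m : ℝ) : ℝ := Real.cosh m / Real.sinh m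

/-- The generator `𝔍`: multiplication by `ξ₄ = cosh μ`. -/
def opJ (ψ : Chart → ℂ) (x : Chart) : ℂ := (Real.cosh x.1 : ℂ) * ψ x

/-- The generators `Pⁱ`: multiplication by `ξᵢ = sinh μ · gᵢ(θ₁, θ₂)`. -/
def opP (i : Fin 3) (ψ : Chart → ℂ) (x : Chart) : ℂ :=
  ((Real.sinh x.1 * direction i x : ℝ) : ℂ) * ψ x

/-- The generators `Qⁱ` (boosts) as first order differential operators. -/
def opQ : Fin 3 → (Chart → ℂ) → Chart → ℂ
  | 0, ψ, x => Complex.I *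
      (((Real.sin x.2.1 * Real.cos x.2.2 : ℝ) : ℂ) * partialMu ψ x
        + (coth x.1 : ℂ) *
          (((Real.cos x.2.1 * Real.cos x.2.2 : ℝ) : ℂ) * partialTheta1 ψ x
            - ((Real.sin x.2.2 / Real.sin x.2.1 : ℝ) : ℂ) * partialTheta2 ψ x))
  | 1, ψ, x => Complex.I *
      (((Real.sin x.2.1 * Real.sin x.2.2 : ℝ) : ℂ) * partialMu ψ x
        + (coth x.1 : ℂ) *
          (((Real.cos x.2.1 * Real.sin x.2.2 : ℝ) : ℂ) * partialTheta1 ψ x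
            + ((Real.cos x.2.2 / Real.sin x.2.1 : ℝ) : ℂ) * partialTheta2 ψ x))
  | 2, ψ, x => Complex.I *
      ((Real.cos x.2.1 : ℂ) * partialMu ψ x
        - (coth x.1 : ℂ) * (Real.sin x.2.1 : ℂ) * partialTheta1 ψ x)

/-- `A₋ⁱ = (Qⁱ + i Pⁱ) / √2`. -/
def opAminus (i : Fin 3) (ψ : Chart → ℂ) (x : Chart) : ℂ :=
  1 / (Real.sqrt 2 : ℂ) * (opQ i ψ x + Complex.I * opP i ψ x)

/-- `A₊ⁱ = (Qⁱ - i Pⁱ) / √2`. -/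
def opAplus (i : Fin 3) (ψ : Chart → ℂ) (x : Chart) : ℂ :=
  1 / (Real.sqrt 2 : ℂ) * (opQ i ψ x - Complex.I * opP i ψ x)

/-- The measure `dΩ = sin θ₁ dθ₁ dθ₂` on `0 < θ₁ < π`, `0 < θ₂ < 2π`. -/
def sphereMeasure : Measure (ℝ × ℝ) :=
  ((volume.restrict (Ioo 0 Real.pi)).withDensity fun a => ENNReal.ofReal (Real.sin a)).prod
    (volume.restrict (Ioo 0 (2 * Real.pi)))

/-- The measure `dμ dΩ`, `μ ∈ ℝ`. The squared norm of `exp (-cosh μ)` for it is `8π K₀(2)`. -/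
def coordMeasure : Measure Chart := (volume : Measure ℝ).prod sphereMeasure

/-- The Lorentz invariant measure `sinh² μ dμ dΩ`, `μ > 0`, of the hyperboloid. -/
def invMeasure : Measure Chart :=
  ((volume.restrict (Ioi 0)).withDensity fun m => ENNReal.ofReal (Real.sinh m ^ 2)).prod
    sphereMeasure

/-- The normalized spherically symmetric state `ψ₀ = N^(-1/2) exp (-cosh μ)`, where `N` is the
squared norm of `exp (-cosh μ)` in `V₃ = L²(ν)`. -/
def psi0 (ν : Measure Chart) (x : Chart) : ℂ :=
  ((1 / Real.sqrt (∫ y : Chart, Real.exp (-Real.cosh y.1) ^ 2 ∂ν)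
    * Real.exp (-Real.cosh x.1) : ℝ) : ℂ)

/-- Lebesgue measure on the half-line `ℝ₊ = [0, ∞)`, so that `h = L²(timeMeasure)`. -/
def timeMeasure : Measure ℝ := volume.restrict (Ici 0)

/-- Functions of `(s, x)`, `s` in the half-line and `x` in the hyperboloid: the vectors of
`H₃ = h ⊗ V₃ = L²(timeMeasure × ν)` are (classes of) such functions, see `InH`. -/
abbrev Vec : Type := ℝ → Chart → ℂ

/-- Operators acting on such functions; their product is the composition `∘`, and sums,
differences and scalar multiples are pointwise. -/
abbrev Op : Type := Vec → Vec

/-- `F` is square integrable, that is, `F` represents a vector of `H₃ = h ⊗ V₃`. -/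
def InH (ν : Measure Chart) (F : Vec) : Prop :=
  MemLp (fun p : ℝ × Chart => F p.1 p.2) 2 (timeMeasure.prod ν)

/-- `F` and `G` represent the same vector of `H₃`. -/
def SameVec (ν : Measure Chart) (F G : Vec) : Prop :=
  (fun p : ℝ × Chart => F p.1 p.2) =ᵐ[timeMeasure.prod ν] fun p => G p.1 p.2

/-- The scalar product of `H₃`. -/
def innerH (ν : Measure Chart) (F G : Vec) : ℂ :=
  ∫ p : ℝ × Chart, conj (F p.1 p.2) * G p.1 p.2 ∂(timeMeasure.prod ν)

/-- The vector `ψ(g) = g ⊗ ψ`. -/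
def tensor (g : ℝ → ℂ) (ψ : Chart → ℂ) : Vec := fun s x => g s * ψ x

/-- For an operator `B` on `V₃` and a function `f` on the half-line, `B(f)` is the operator
(multiplication by `f`) `⊗ B`, so that `B(f) ψ(g) = (B ψ)(f g)`. -/
def smear (B : (Chart → ℂ) → Chart → ℂ) (f : ℝ → ℂ) : Op :=
  fun F s x => f s * B (F s) x

/-- The process `B(t) = B(χ_[0,t])`. -/
def process (B : (Chart → ℂ) → Chart → ℂ) (t : ℝ) : Op :=
  smear B ((Icc 0 t).indicator 1)

/-- The stochastic differential `dB(t) = B(t + dt) - B(t)`. -/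
def differential (B : (Chart → ℂ) → Chart → ℂ) (t dt : ℝ) : Op :=
  process B (t + dt) - process B t

/-- `B(dt) = B(χ_dt)`, where `χ_dt` is the indicator function of the interval from `t` to
`t + dt`. -/
def onInterval (B : (Chart → ℂ) → Chart → ℂ) (t dt : ℝ) : Op :=
  smear B ((Ioc t (t + dt)).indicator 1)

/-- `X` and `Y` map every vector `ψ₀(g)`, `g ∈ h`, to one and the same vector of `H₃`. -/
def EqOnState (ν : Measure Chart) (X Y : Op) : Prop :=
  ∀ g : ℝ → ℂ, MemLp g 2 timeMeasure →
    InH ν (X (tensor g (psi0 ν))) ∧ InH ν (Y (tensor g (psi0 ν))) ∧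
      SameVec ν (X (tensor g (psi0 ν))) (Y (tensor g (psi0 ν)))

/-- `X` and `Y` have the same expectations in the state `ψ₀`: `X ψ₀(g)` and `Y ψ₀(g)` are vectors
of `H₃`, and `⟨ψ₀(f), X ψ₀(g)⟩ = ⟨ψ₀(f), Y ψ₀(g)⟩` for all `f, g ∈ h`. -/
def EqInExpectation (ν : Measure Chart) (X Y : Op) : Prop :=
  ∀ f g : ℝ → ℂ, MemLp f 2 timeMeasure → MemLp g 2 timeMeasure →
    InH ν (X (tensor g (psi0 ν))) ∧ InH ν (Y (tensor g (psi0 ν))) ∧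
      innerH ν (tensor f (psi0 ν)) (X (tensor g (psi0 ν)))
        = innerH ν (tensor f (psi0 ν)) (Y (tensor g (psi0 ν)))

end IsoThreeOne

end

/-!
The boosts `Qⁱ` are `i` times the derivations `gᵢ ∂_μ + coth μ · (∇_{S²})ᵢ`, so by the Leibniz rule
their commutators with the multiplication operators are read off from their values on the
coordinates: `Qⁱ ξ₄ = i ξᵢ` and `Qⁱ ξⱼ = i δⁱʲ ξ₄`, the latter because `g` and the two tangent
vectors `∂g/∂θ₁`, `(sin θ₁)⁻¹ ∂g/∂θ₂` form an orthonormal frame. Since `Qⁱ ψ₀ = -i Pⁱ ψ₀`, the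
operator `A₋ⁱ` annihilates `ψ₀`, and `A₊ⁱ = A₋ⁱ - √2 i Pⁱ`. Hence `A₋ⁱ A₊ʲ ψ₀` and `A₋ⁱ 𝔍 ψ₀` reduce
to the commutators `[A₋ⁱ, Pʲ] = (i / √2) δⁱʲ 𝔍` and `[A₋ⁱ, 𝔍] = (i / √2) Pⁱ`, while
`½ (A₋ⁱ - A₊ⁱ) = (i / √2) Pⁱ`. The two rules that start with `𝔍` hold in expectation only: all the
expectations in them vanish, because `ξᵢ` has mean zero on every sphere `μ = const`.
-/

namespace IsoThreeOne

section Measures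

lemma neZero_withDensity_ofReal {α : Type*} [MeasurableSpace α] {ρ : Measure α} [NeZero ρ]
    {f : α → ℝ} (hf : AEMeasurable f ρ) (hpos : ∀ᵐ x ∂ρ, 0 < f x) :
    NeZero (ρ.withDensity fun x => ENNReal.ofReal (f x)) := by
  refine ⟨fun h => ?_⟩
  rw [withDensity_eq_zero_iff hf.ennreal_ofReal] at h
  obtain ⟨x, hx, hx'⟩ := (hpos.and h).exists
  exact (ENNReal.ofReal_pos.2 hx).ne' hx'

lemma neZero_prod {α β : Type*} [MeasurableSpace α] [MeasurableSpace β] (ρ : Measure α)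
    (σ : Measure β) [SFinite σ] [NeZero ρ] [NeZero σ] : NeZero (ρ.prod σ) := by
  rw [neZero_iff, ← Measure.measure_univ_ne_zero, ← univ_prod_univ, Measure.prod_prod]
  exact mul_ne_zero (NeZero.ne _) (NeZero.ne _)

/-- The colatitude factor `sin θ₁ dθ₁` of the measure `dΩ`. -/
noncomputable abbrev polarMeasure : Measure ℝ :=
  (volume.restrict (Ioo 0 Real.pi)).withDensity fun a => ENNReal.ofReal (Real.sin a)

lemma ae_sin_pos : ∀ᵐ a ∂volume.restrict (Ioo 0 Real.pi), 0 < Real.sin a := by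
  filter_upwards [ae_restrict_mem measurableSet_Ioo] with a ha using Real.sin_pos_of_mem_Ioo ha

lemma sphereMeasure_eq :
    sphereMeasure = polarMeasure.prod (volume.restrict (Ioo 0 (2 * Real.pi))) := rfl

instance : IsFiniteMeasure polarMeasure :=
  isFiniteMeasure_withDensity_ofReal
    ((Real.continuous_sin.integrableOn_Icc (a := 0) (b := Real.pi)).mono_set
      Ioo_subset_Icc_self).hasFiniteIntegral

instance : IsFiniteMeasure sphereMeasure := by
  rw [sphereMeasure_eq]
  infer_instance

instance : NeZero sphereMeasure := by
  have restrict_Ioo_neZero {b : ℝ} (hb : 0 < b) : NeZero (volume.restrict (Ioo 0 b)) :=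
    ⟨by simp [Measure.restrict_eq_zero, hb]⟩
  have := restrict_Ioo_neZero Real.pi_pos
  have := restrict_Ioo_neZero Real.two_pi_pos
  have : NeZero polarMeasure := neZero_withDensity_ofReal (by fun_prop) ae_sin_pos
  rw [sphereMeasure_eq]
  exact neZero_prod _ _

lemma ae_sphereMeasure_sin_ne_zero : ∀ᵐ y ∂sphereMeasure, Real.sin y.1 ≠ 0 := by
  rw [sphereMeasure_eq]
  refine Measure.quasiMeasurePreserving_fst.ae (p := fun a : ℝ => Real.sin a ≠ 0) ?_
  exact (withDensity_absolutelyContinuous _ _).ae_le (ae_sin_pos.mono fun _ h => h.ne')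

lemma integral_cos_polarMeasure : ∫ a, Real.cos a ∂polarMeasure = 0 := by
  rw [integral_withDensity_eq_integral_toReal_smul (by fun_prop) (by simp)]
  calc ∫ a in Ioo 0 Real.pi, (ENNReal.ofReal (Real.sin a)).toReal • Real.cos a
      = ∫ a in Ioo 0 Real.pi, Real.sin a * Real.cos a :=
        integral_congr_ae <| ae_sin_pos.mono fun a ha => by
          simp only [ENNReal.toReal_ofReal ha.le, smul_eq_mul]
    _ = ∫ a in 0..Real.pi, Real.sin a * Real.cos a := by
        rw [intervalIntegral.integral_of_le Real.pi_pos.le, integral_Ioc_eq_integral_Ioo]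
    _ = 0 := by simp [integral_sin_mul_cos₁]

lemma integral_direction (i : Fin 3) (m : ℝ) : ∫ y, direction i (m, y) ∂sphereMeasure = 0 := by
  have integral_azimuth (f : ℝ → ℝ) :
      ∫ b in Ioo 0 (2 * Real.pi), f b = ∫ b in 0..2 * Real.pi, f b := by
    rw [intervalIntegral.integral_of_le Real.two_pi_pos.le, integral_Ioc_eq_integral_Ioo]
  rw [sphereMeasure_eq]
  fin_cases i
  · calc ∫ y : ℝ × ℝ, Real.sin y.1 * Real.cos y.2 ∂_ = _ := integral_prod_mul _ _
      _ = 0 := by rw [integral_azimuth]; simp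
  · calc ∫ y : ℝ × ℝ, Real.sin y.1 * Real.sin y.2 ∂_ = _ := integral_prod_mul _ _
      _ = 0 := by rw [integral_azimuth]; simp
  · calc ∫ y : ℝ × ℝ, Real.cos y.1 ∂_ = _ := integral_fun_fst _
      _ = 0 := by rw [integral_cos_polarMeasure, smul_zero]

/-- The rotation invariant measure `dρ(μ) dΩ` with radial part `ρ`. -/
noncomputable abbrev sphericalMeasure (ρ : Measure ℝ) : Measure Chart := ρ.prod sphereMeasure

/-- Admissible radial parts `ρ` of a rotation invariant measure `dρ(μ) dΩ`: the singularity `μ = 0`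
of the coordinates is negligible, and `cosh² μ · exp (-cosh μ)`, which dominates everything that
products of two generators make of `ψ₀`, is square integrable. -/
class IsAdmissibleRadial (ρ : Measure ℝ) : Prop extends SFinite ρ, NeZero ρ where
  ae_ne_zero : ∀ᵐ m ∂ρ, m ≠ 0
  memLp : MemLp (fun m => Real.cosh m ^ 2 * Real.exp (-Real.cosh m)) 2 ρ

lemma sq_div_four_le_cosh (m : ℝ) : m ^ 2 / 4 ≤ Real.cosh m := by
  have quadratic_le := Real.quadratic_le_exp_of_nonneg (abs_nonneg m)
  rw [sq_abs] at quadratic_le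
  rw [← Real.cosh_abs, Real.cosh_eq]
  linarith [Real.exp_pos (-|m|), abs_nonneg m]

lemma cosh_pow_mul_exp_neg_cosh_sq_le (n : ℕ) (m : ℝ) :
    Real.cosh m ^ n * Real.exp (-Real.cosh m) ^ 2
      ≤ n.factorial * Real.exp (-(1 / 4) * m ^ 2) := by
  have pow_le : Real.cosh m ^ n ≤ n.factorial * Real.exp (Real.cosh m) := by
    rw [← div_le_iff₀' (by positivity)]
    exact Real.pow_div_factorial_le_exp _ (Real.cosh_pos m).le n
  calc Real.cosh m ^ n * Real.exp (-Real.cosh m) ^ 2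
      ≤ n.factorial * Real.exp (Real.cosh m) * Real.exp (-Real.cosh m) ^ 2 := by gcongr
    _ = n.factorial * Real.exp (-Real.cosh m) := by
        rw [mul_assoc, ← Real.exp_nat_mul, ← Real.exp_add]
        ring_nf
    _ ≤ n.factorial * Real.exp (-(1 / 4) * m ^ 2) := by
        gcongr
        linarith [sq_div_four_le_cosh m]

lemma integrable_cosh_pow_mul_exp_neg_cosh_sq (n : ℕ) :
    Integrable fun m => Real.cosh m ^ n * Real.exp (-Real.cosh m) ^ 2 := by
  refine ((integrable_exp_neg_mul_sq (b := 1 / 4) (by norm_num)).const_mul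
    (n.factorial : ℝ)).mono' (by fun_prop) (.of_forall fun m => ?_)
  have := Real.cosh_pos m
  rw [Real.norm_of_nonneg (by positivity)]
  exact cosh_pow_mul_exp_neg_cosh_sq_le n m

instance : IsAdmissibleRadial volume where
  ae_ne_zero := Measure.ae_ne _ _
  memLp := by
    rw [memLp_two_iff_integrable_sq (by fun_prop)]
    simpa only [mul_pow, ← pow_mul] using integrable_cosh_pow_mul_exp_neg_cosh_sq 4

instance : IsAdmissibleRadial
    ((volume.restrict (Ioi 0)).withDensity fun m => ENNReal.ofReal (Real.sinh m ^ 2)) where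
  toNeZero := by
    have : NeZero (volume.restrict (Ioi (0 : ℝ))) := ⟨by simp [Measure.restrict_eq_zero]⟩
    refine neZero_withDensity_ofReal (by fun_prop) ?_
    filter_upwards [ae_restrict_mem measurableSet_Ioi] with m hm
      using pow_pos (Real.sinh_pos_iff.2 hm) 2
  ae_ne_zero :=
    (withDensity_absolutelyContinuous _ _).ae_le (ae_restrict_of_ae (Measure.ae_ne _ _))
  memLp := by
    rw [memLp_two_iff_integrable_sq (by fun_prop),
      integrable_withDensity_iff (by fun_prop) (by simp)]
    refine (integrable_cosh_pow_mul_exp_neg_cosh_sq 6).restrict.mono' (by fun_prop)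
      (.of_forall fun m => ?_)
    rw [ENNReal.toReal_ofReal (sq_nonneg _), Real.norm_of_nonneg (by positivity)]
    calc (Real.cosh m ^ 2 * Real.exp (-Real.cosh m)) ^ 2 * Real.sinh m ^ 2
        ≤ (Real.cosh m ^ 2 * Real.exp (-Real.cosh m)) ^ 2 * Real.cosh m ^ 2 :=
          mul_le_mul_of_nonneg_left (by linarith [Real.cosh_sq m]) (sq_nonneg _)
      _ = Real.cosh m ^ 6 * Real.exp (-Real.cosh m) ^ 2 := by ring

lemma ae_sinh_ne_zero_and_sin_ne_zero (ρ : Measure ℝ) [IsAdmissibleRadial ρ] :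
    ∀ᵐ x ∂sphericalMeasure ρ, Real.sinh x.1 ≠ 0 ∧ Real.sin x.2.1 ≠ 0 := by
  filter_upwards [Measure.quasiMeasurePreserving_fst.ae IsAdmissibleRadial.ae_ne_zero,
    Measure.quasiMeasurePreserving_snd.ae ae_sphereMeasure_sin_ne_zero] with x hμ hθ
  exact ⟨Real.sinh_ne_zero.2 hμ, hθ⟩

end Measures

section Generators

/-- The coordinate `ξ₄ = cosh μ`. -/
noncomputable def timeCoord (x : Chart) : ℂ := (Real.cosh x.1 : ℂ)

/-- The coordinate `ξᵢ = sinh μ · gᵢ(θ₁, θ₂)`. -/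
noncomputable def spaceCoord (i : Fin 3) (x : Chart) : ℂ :=
  ((Real.sinh x.1 * direction i x : ℝ) : ℂ)

/-- The unit tangent vector `∂g/∂θ₁` of the sphere at `g(θ₁, θ₂)`. -/
noncomputable def polarTangent : Fin 3 → Chart → ℝ
  | 0, x => Real.cos x.2.1 * Real.cos x.2.2
  | 1, x => Real.cos x.2.1 * Real.sin x.2.2
  | 2, x => -Real.sin x.2.1

/-- The unit tangent vector `(sin θ₁)⁻¹ ∂g/∂θ₂` of the sphere at `g(θ₁, θ₂)`. -/
noncomputable def azimuthTangent : Fin 3 → Chart → ℝ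
  | 0, x => -Real.sin x.2.2
  | 1, x => Real.cos x.2.2
  | 2, _ => 0

variable {φ ψ : Chart → ℂ} {x : Chart}

lemma direction_mk_angles (i : Fin 3) (m : ℝ) (x : Chart) :
    direction i (m, x.2.1, x.2.2) = direction i x := by
  fin_cases i <;> rfl

lemma hasDerivAt_direction_polar (i : Fin 3) (x : Chart) :
    HasDerivAt (fun a => direction i (x.1, a, x.2.2)) (polarTangent i x) x.2.1 := by
  fin_cases i
  · exact (Real.hasDerivAt_sin x.2.1).mul_const (Real.cos x.2.2)
  · exact (Real.hasDerivAt_sin x.2.1).mul_const (Real.sin x.2.2)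
  · exact Real.hasDerivAt_cos x.2.1

lemma hasDerivAt_direction_azimuth (i : Fin 3) (x : Chart) :
    HasDerivAt (fun b => direction i (x.1, x.2.1, b))
      (Real.sin x.2.1 * azimuthTangent i x) x.2.2 := by
  fin_cases i
  · exact (Real.hasDerivAt_cos x.2.2).const_mul (Real.sin x.2.1)
  · exact (Real.hasDerivAt_sin x.2.2).const_mul (Real.sin x.2.1)
  · exact (hasDerivAt_const x.2.2 (Real.cos x.2.1)).congr_deriv (mul_zero (Real.sin x.2.1)).symm

lemma sphere_frame_completeness (i j : Fin 3) (x : Chart) :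
    direction i x * direction j x + polarTangent i x * polarTangent j x
      + azimuthTangent i x * azimuthTangent j x = if i = j then 1 else 0 := by
  have polar_sq := Real.sin_sq_add_cos_sq x.2.1
  have azimuth_sq := Real.sin_sq_add_cos_sq x.2.2
  fin_cases i <;> fin_cases j <;> simp only [direction, polarTangent, azimuthTangent] <;> grind

lemma opQ_eq_frame (i : Fin 3) (φ : Chart → ℂ) (x : Chart) :
    opQ i φ x = Complex.I * (direction i x * partialMu φ x + (coth x.1 : ℂ) *
      (polarTangent i x * partialTheta1 φ x
        + azimuthTangent i x / Real.sin x.2.1 * partialTheta2 φ x)) := by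
  fin_cases i <;>
    simp only [opQ, direction, polarTangent,
      azimuthTangent, Complex.ofReal_mul, Complex.ofReal_neg, Complex.ofReal_div,
      Complex.ofReal_zero] <;>
    ring

lemma opQ_mul (i : Fin 3) (hφ : DifferentiableAt ℝ φ x) (hψ : DifferentiableAt ℝ ψ x) :
    opQ i (φ * ψ) x = opQ i φ x * ψ x + φ x * opQ i ψ x := by
  have partialMu_mul :
      partialMu (φ * ψ) x = partialMu φ x * ψ x + φ x * partialMu ψ x :=
    deriv_fun_mul (hφ.fun_comp' x.1 (by fun_prop)) (hψ.fun_comp' x.1 (by fun_prop))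
  have partialTheta1_mul :
      partialTheta1 (φ * ψ) x = partialTheta1 φ x * ψ x + φ x * partialTheta1 ψ x :=
    deriv_fun_mul (hφ.fun_comp' x.2.1 (by fun_prop)) (hψ.fun_comp' x.2.1 (by fun_prop))
  have partialTheta2_mul :
      partialTheta2 (φ * ψ) x = partialTheta2 φ x * ψ x + φ x * partialTheta2 ψ x :=
    deriv_fun_mul (hφ.fun_comp' x.2.2 (by fun_prop)) (hψ.fun_comp' x.2.2 (by fun_prop))
  simp only [opQ_eq_frame, partialMu_mul, partialTheta1_mul, partialTheta2_mul]
  ring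

lemma opQ_radial (i : Fin 3) (F : ℝ → ℂ) (x : Chart) :
    opQ i (fun y => F y.1) x = Complex.I * (direction i x * deriv F x.1) := by
  simp only [opQ_eq_frame, partialMu, partialTheta1, partialTheta2, deriv_const, mul_zero,
    add_zero]

lemma opQ_timeCoord (i : Fin 3) (x : Chart) :
    opQ i timeCoord x = Complex.I * spaceCoord i x := by
  have deriv_cosh := (Real.hasDerivAt_cosh x.1).ofReal_comp.deriv
  refine (opQ_radial i (fun m => (Real.cosh m : ℂ)) x).trans ?_
  rw [deriv_cosh, spaceCoord, Complex.ofReal_mul, mul_comm (direction i x : ℂ)]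

lemma opQ_spaceCoord (i j : Fin 3) (hsinh : Real.sinh x.1 ≠ 0) (hsin : Real.sin x.2.1 ≠ 0) :
    opQ i (spaceCoord j) x = Complex.I * (if i = j then 1 else 0) * timeCoord x := by
  have partialMu_eq : partialMu (spaceCoord j) x = (Real.cosh x.1 * direction j x : ℝ) := by
    simp only [partialMu, spaceCoord, direction_mk_angles]
    exact ((Real.hasDerivAt_sinh x.1).mul_const (direction j x)).ofReal_comp.deriv
  have partialTheta1_eq :
      partialTheta1 (spaceCoord j) x = (Real.sinh x.1 * polarTangent j x : ℝ) :=
    ((hasDerivAt_direction_polar j x).const_mul (Real.sinh x.1)).ofReal_comp.deriv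
  have partialTheta2_eq : partialTheta2 (spaceCoord j) x
      = (Real.sinh x.1 * (Real.sin x.2.1 * azimuthTangent j x) : ℝ) :=
    ((hasDerivAt_direction_azimuth j x).const_mul (Real.sinh x.1)).ofReal_comp.deriv
  have frame : (if i = j then 1 else 0 : ℂ) = (direction i x * direction j x
      + polarTangent i x * polarTangent j x + azimuthTangent i x * azimuthTangent j x : ℝ) := by
    rw [sphere_frame_completeness]
    split_ifs <;> simp
  rw [opQ_eq_frame, partialMu_eq, partialTheta1_eq, partialTheta2_eq, frame, timeCoord, coth]
  rw [mul_assoc]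
  congr 1
  norm_cast
  field_simp
  ring

lemma measurable_direction (i : Fin 3) : Measurable (direction i) := by
  fin_cases i <;> simp only [Fin.zero_eta, Fin.mk_one, Fin.reduceFinMk] <;> unfold direction <;>
    fun_prop

lemma differentiable_direction (i : Fin 3) : Differentiable ℝ (direction i) := by
  fin_cases i <;> simp only [Fin.zero_eta, Fin.mk_one, Fin.reduceFinMk] <;> unfold direction <;>
    fun_prop

lemma differentiable_timeCoord : Differentiable ℝ timeCoord := by
  unfold timeCoord
  fun_prop

lemma differentiable_spaceCoord (i : Fin 3) : Differentiable ℝ (spaceCoord i) := by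
  have := differentiable_direction i
  unfold spaceCoord
  fun_prop

lemma opQ_opJ (i : Fin 3) (hφ : DifferentiableAt ℝ φ x) :
    opQ i (opJ φ) x = opJ (opQ i φ) x + Complex.I * opP i φ x := by
  refine (opQ_mul i (differentiable_timeCoord x) hφ).trans ?_
  rw [opQ_timeCoord]
  simp only [opJ, opP, timeCoord, spaceCoord]
  ring

lemma opQ_opP (i j : Fin 3) (hφ : DifferentiableAt ℝ φ x) (hsinh : Real.sinh x.1 ≠ 0)
    (hsin : Real.sin x.2.1 ≠ 0) :
    opQ i (opP j φ) x
      = opP j (opQ i φ) x + Complex.I * (if i = j then 1 else 0) * opJ φ x := by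
  refine (opQ_mul i (differentiable_spaceCoord j x) hφ).trans ?_
  rw [opQ_spaceCoord i j hsinh hsin]
  simp only [opJ, opP, timeCoord, spaceCoord]
  ring

lemma opAminus_opJ (i : Fin 3) (hφ : DifferentiableAt ℝ φ x) :
    opAminus i (opJ φ) x = opJ (opAminus i φ) x + Complex.I / (Real.sqrt 2 : ℂ) * opP i φ x := by
  simp only [opAminus, opQ_opJ i hφ, opJ, opP]
  ring

lemma opAminus_opP (i j : Fin 3) (hφ : DifferentiableAt ℝ φ x) (hsinh : Real.sinh x.1 ≠ 0)
    (hsin : Real.sin x.2.1 ≠ 0) :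
    opAminus i (opP j φ) x = opP j (opAminus i φ) x
      + Complex.I / (Real.sqrt 2 : ℂ) * (if i = j then 1 else 0) * opJ φ x := by
  simp only [opAminus, opQ_opP i j hφ hsinh hsin, opJ, opP]
  ring

lemma opJ_opP (i : Fin 3) (φ : Chart → ℂ) : opJ (opP i φ) = opP i (opJ φ) := by
  ext x
  simp only [opJ, opP]
  ring

lemma ofReal_sqrt_two_mul_self : (Real.sqrt 2 : ℂ) * (Real.sqrt 2 : ℂ) = 2 := by
  exact_mod_cast Real.mul_self_sqrt zero_le_two

lemma ofReal_sqrt_two_ne_zero : (Real.sqrt 2 : ℂ) ≠ 0 :=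
  Complex.ofReal_ne_zero.2 (by positivity)

lemma opAplus_eq_opAminus_sub (i : Fin 3) (φ : Chart → ℂ) :
    opAplus i φ = opAminus i φ - ((Real.sqrt 2 : ℂ) * Complex.I) • opP i φ := by
  ext x
  simp only [opAplus, opAminus, Pi.sub_apply, Pi.smul_apply, smul_eq_mul]
  field_simp [ofReal_sqrt_two_ne_zero]
  linear_combination Complex.I * opP i φ x * ofReal_sqrt_two_mul_self

lemma half_smul_opAminus_sub_opAplus (i : Fin 3) (φ : Chart → ℂ) :
    (1 / 2 : ℂ) • (opAminus i φ - opAplus i φ)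
      = (Complex.I / (Real.sqrt 2 : ℂ)) • opP i φ := by
  rw [opAplus_eq_opAminus_sub, sub_sub_cancel, smul_smul]
  congr 1
  field_simp [ofReal_sqrt_two_ne_zero]
  linear_combination ofReal_sqrt_two_mul_self

end Generators

section Homogeneous

/-- `B` commutes with multiplication by scalars. This is the only part of linearity needed to
evaluate `B(f)` on the vectors `ψ(g)`. -/
def IsHomogeneous (B : (Chart → ℂ) → Chart → ℂ) : Prop :=
  ∀ (c : ℂ) (φ : Chart → ℂ), B (c • φ) = c • B φ

lemma IsHomogeneous.map_zero {B : (Chart → ℂ) → Chart → ℂ} (hB : IsHomogeneous B) : B 0 = 0 := by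
  simpa only [zero_smul] using hB 0 0

lemma isHomogeneous_opJ : IsHomogeneous opJ := fun c φ => by
  ext x
  exact mul_left_comm _ _ _

lemma isHomogeneous_opP (i : Fin 3) : IsHomogeneous (opP i) := fun c φ => by
  ext x
  exact mul_left_comm _ _ _

lemma isHomogeneous_opQ (i : Fin 3) : IsHomogeneous (opQ i) := fun c φ => by
  ext x
  simp only [opQ_eq_frame, partialMu, partialTheta1, partialTheta2, Pi.smul_apply, smul_eq_mul,
    deriv_const_mul_field]
  ring

lemma isHomogeneous_opAminus (i : Fin 3) : IsHomogeneous (opAminus i) := fun c φ => by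
  ext x
  simp only [opAminus, isHomogeneous_opQ i c φ, isHomogeneous_opP i c φ, Pi.smul_apply,
    smul_eq_mul]
  ring

lemma isHomogeneous_opAplus (i : Fin 3) : IsHomogeneous (opAplus i) := fun c φ => by
  simp only [opAplus_eq_opAminus_sub, isHomogeneous_opAminus i c φ, isHomogeneous_opP i c φ,
    smul_sub, smul_comm c]

end Homogeneous

section State

lemma hasDerivAt_psi0 (ν : Measure Chart) (m : ℝ) (y : ℝ × ℝ) :
    HasDerivAt (fun m => psi0 ν (m, y)) (-(Real.sinh m : ℂ) * psi0 ν (m, y)) m := by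
  refine ((Real.hasDerivAt_cosh m).fun_neg.exp.const_mul _).ofReal_comp.congr_deriv ?_
  simp only [psi0]
  push_cast
  ring

lemma differentiable_psi0 (ν : Measure Chart) : Differentiable ℝ (psi0 ν) := by
  unfold psi0
  fun_prop

lemma opQ_psi0 (ν : Measure Chart) (i : Fin 3) :
    opQ i (psi0 ν) = (-Complex.I) • opP i (psi0 ν) := by
  ext x
  refine (opQ_radial i (fun m => psi0 ν (m, x.2)) x).trans ?_
  rw [(hasDerivAt_psi0 ν x.1 x.2).deriv]
  simp only [opP, Pi.smul_apply, smul_eq_mul]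
  push_cast
  ring

lemma opAminus_psi0 (ν : Measure Chart) (i : Fin 3) : opAminus i (psi0 ν) = 0 := by
  ext x
  simp [opAminus, opQ_psi0]

lemma opAplus_psi0 (ν : Measure Chart) (i : Fin 3) :
    opAplus i (psi0 ν) = -((Real.sqrt 2 : ℂ) * Complex.I) • opP i (psi0 ν) := by
  rw [opAplus_eq_opAminus_sub, opAminus_psi0, zero_sub, neg_smul]

lemma opAminus_opJ_psi0 (ν : Measure Chart) (i : Fin 3) :
    opAminus i (opJ (psi0 ν)) = (Complex.I / (Real.sqrt 2 : ℂ)) • opP i (psi0 ν) := by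
  ext x
  rw [opAminus_opJ i (differentiable_psi0 ν x), opAminus_psi0, isHomogeneous_opJ.map_zero,
    Pi.zero_apply, zero_add, Pi.smul_apply, smul_eq_mul]

lemma opAminus_opAplus_psi0 (ν : Measure Chart) (i j : Fin 3) {x : Chart}
    (hsinh : Real.sinh x.1 ≠ 0) (hsin : Real.sin x.2.1 ≠ 0) :
    opAminus i (opAplus j (psi0 ν)) x
      = ((if i = j then (1 : ℂ) else 0) • opJ (psi0 ν)) x := by
  rw [opAplus_psi0, isHomogeneous_opAminus, Pi.smul_apply,
    opAminus_opP i j (differentiable_psi0 ν x) hsinh hsin, opAminus_psi0,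
    (isHomogeneous_opP j).map_zero, Pi.zero_apply, zero_add, Pi.smul_apply, smul_eq_mul,
    smul_eq_mul]
  field_simp [ofReal_sqrt_two_ne_zero]
  rw [Complex.I_sq]
  ring

lemma measurable_psi0 (ν : Measure Chart) : Measurable (psi0 ν) := by
  unfold psi0
  fun_prop

lemma norm_psi0 (ν : Measure Chart) (x : Chart) :
    ‖psi0 ν x‖ = 1 / Real.sqrt (∫ y : Chart, Real.exp (-Real.cosh y.1) ^ 2 ∂ν)
      * Real.exp (-Real.cosh x.1) := by
  rw [psi0, Complex.norm_real, Real.norm_of_nonneg (by positivity)]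

lemma abs_direction_le_one (i : Fin 3) (x : Chart) : |direction i x| ≤ 1 := by
  have frame := sphere_frame_completeness i i x
  rw [if_pos rfl] at frame
  refine abs_le_one_iff_mul_self_le_one.2 ?_
  linarith [mul_self_nonneg (polarTangent i x), mul_self_nonneg (azimuthTangent i x)]

lemma norm_timeCoord (x : Chart) : ‖timeCoord x‖ = Real.cosh x.1 := by
  rw [timeCoord, Complex.norm_real, Real.norm_of_nonneg (Real.cosh_pos _).le]

lemma norm_spaceCoord_le (i : Fin 3) (x : Chart) : ‖spaceCoord i x‖ ≤ Real.cosh x.1 := by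
  have abs_sinh_le_cosh : |Real.sinh x.1| ≤ Real.cosh x.1 := by
    rw [Real.abs_sinh, ← Real.cosh_abs]
    exact (Real.sinh_lt_cosh _).le
  rw [spaceCoord, Complex.norm_real, Real.norm_eq_abs, abs_mul]
  exact (mul_le_of_le_one_right (abs_nonneg _) (abs_direction_le_one i x)).trans abs_sinh_le_cosh

lemma measurable_timeCoord : Measurable timeCoord := by
  unfold timeCoord
  fun_prop

lemma measurable_spaceCoord (i : Fin 3) : Measurable (spaceCoord i) := by
  have := measurable_direction i
  unfold spaceCoord
  fun_prop

lemma memLp_opAminus_psi0 (ν : Measure Chart) (i : Fin 3) :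
    MemLp (opAminus i (psi0 ν)) 2 ν := by
  rw [opAminus_psi0]
  exact MemLp.zero

variable (ρ : Measure ℝ)

lemma integral_conj_mul_opP_radial [SFinite ρ] (F G : ℝ → ℂ) (i : Fin 3) :
    ∫ x, conj (F x.1) * opP i (fun y => G y.1) x ∂sphericalMeasure ρ = 0 := by
  calc ∫ x, conj (F x.1) * opP i (fun y => G y.1) x ∂sphericalMeasure ρ
      = ∫ x, (conj (F x.1) * Real.sinh x.1 * G x.1) * (direction i (0, x.2) : ℂ)
          ∂sphericalMeasure ρ := by
        congr with x
        rw [opP, ← direction_mk_angles i 0 x, Complex.ofReal_mul]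
        ring
    _ = (∫ m, conj (F m) * Real.sinh m * G m ∂ρ)
          * ∫ y, (direction i (0, y) : ℂ) ∂sphereMeasure :=
        integral_prod_mul (fun m => conj (F m) * Real.sinh m * G m)
          fun y => (direction i (0, y) : ℂ)
    _ = 0 := by
        rw [integral_complex_ofReal, integral_direction, Complex.ofReal_zero, mul_zero]

lemma integral_conj_psi0_mul_smul_opP_psi0 [SFinite ρ] (c : ℂ) (i : Fin 3) :
    ∫ x, conj (psi0 (sphericalMeasure ρ) x) * (c • opP i (psi0 (sphericalMeasure ρ))) x
      ∂sphericalMeasure ρ = 0 := by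
  rw [← isHomogeneous_opP]
  exact integral_conj_mul_opP_radial ρ (fun m => psi0 _ (m, 0))
    (fun m => (c • psi0 (sphericalMeasure ρ)) (m, 0)) i

lemma integral_conj_psi0_mul_smul_opJ_opP_psi0 [SFinite ρ] (c : ℂ) (i : Fin 3) :
    ∫ x, conj (psi0 (sphericalMeasure ρ) x) * (c • opJ (opP i (psi0 (sphericalMeasure ρ)))) x
      ∂sphericalMeasure ρ = 0 := by
  rw [opJ_opP, ← isHomogeneous_opP]
  exact integral_conj_mul_opP_radial ρ (fun m => psi0 _ (m, 0))
    (fun m => (c • opJ (psi0 (sphericalMeasure ρ))) (m, 0)) i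

variable [IsAdmissibleRadial ρ]

lemma memLp_mul_psi0 {u : Chart → ℂ} (hu : Measurable u)
    (hle : ∀ x, ‖u x‖ ≤ Real.cosh x.1 ^ 2) :
    MemLp (u * psi0 (sphericalMeasure ρ)) 2 (sphericalMeasure ρ) := by
  obtain ⟨c, norm_eq⟩ : ∃ c, ∀ x, ‖psi0 (sphericalMeasure ρ) x‖ = c * Real.exp (-Real.cosh x.1) :=
    ⟨_, norm_psi0 _⟩
  refine ((IsAdmissibleRadial.memLp.comp_fst sphereMeasure).const_mul c).mono'
    (hu.mul (measurable_psi0 _)).aestronglyMeasurable (.of_forall fun x => ?_)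
  calc ‖u x * psi0 (sphericalMeasure ρ) x‖
      = ‖u x‖ * ‖psi0 (sphericalMeasure ρ) x‖ := norm_mul _ _
    _ ≤ Real.cosh x.1 ^ 2 * ‖psi0 (sphericalMeasure ρ) x‖ := by gcongr; exact hle x
    _ = c * (Real.cosh x.1 ^ 2 * Real.exp (-Real.cosh x.1)) := by rw [norm_eq, mul_left_comm]

lemma memLp_psi0 : MemLp (psi0 (sphericalMeasure ρ)) 2 (sphericalMeasure ρ) := by
  have h := memLp_mul_psi0 ρ (u := 1) measurable_one fun x => by
    rw [Pi.one_apply, norm_one]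
    exact one_le_pow₀ (Real.one_le_cosh x.1)
  rwa [one_mul] at h

lemma memLp_opJ_psi0 : MemLp (opJ (psi0 (sphericalMeasure ρ))) 2 (sphericalMeasure ρ) :=
  memLp_mul_psi0 ρ measurable_timeCoord fun x =>
    (norm_timeCoord x).trans_le (le_self_pow₀ (Real.one_le_cosh _) two_ne_zero)

lemma memLp_opP_psi0 (i : Fin 3) :
    MemLp (opP i (psi0 (sphericalMeasure ρ))) 2 (sphericalMeasure ρ) :=
  memLp_mul_psi0 ρ (measurable_spaceCoord i) fun x =>
    (norm_spaceCoord_le i x).trans (le_self_pow₀ (Real.one_le_cosh _) two_ne_zero)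

lemma memLp_opJ_opP_psi0 (i : Fin 3) :
    MemLp (opJ (opP i (psi0 (sphericalMeasure ρ)))) 2 (sphericalMeasure ρ) := by
  have h := memLp_mul_psi0 ρ (measurable_timeCoord.mul (measurable_spaceCoord i)) fun x => by
    rw [Pi.mul_apply, norm_mul, norm_timeCoord, sq]
    gcongr
    exact norm_spaceCoord_le i x
  rwa [mul_assoc] at h

lemma memLp_opAplus_psi0 (i : Fin 3) :
    MemLp (opAplus i (psi0 (sphericalMeasure ρ))) 2 (sphericalMeasure ρ) := by
  rw [opAplus_psi0]
  exact (memLp_opP_psi0 ρ i).const_smul _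

lemma integrable_exp_neg_cosh_sq :
    Integrable (fun x : Chart => Real.exp (-Real.cosh x.1) ^ 2) (sphericalMeasure ρ) := by
  refine (memLp_two_iff_integrable_sq (by fun_prop)).1 <|
    (IsAdmissibleRadial.memLp.comp_fst sphereMeasure).mono' (by fun_prop) (.of_forall fun x => ?_)
  rw [Real.norm_of_nonneg (Real.exp_pos _).le]
  exact le_mul_of_one_le_left (Real.exp_pos _).le (one_le_pow₀ (Real.one_le_cosh x.1))

lemma integral_exp_neg_cosh_sq_pos :
    0 < ∫ x : Chart, Real.exp (-Real.cosh x.1) ^ 2 ∂sphericalMeasure ρ := by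
  have := neZero_prod ρ sphereMeasure
  have h := integrable_exp_neg_cosh_sq ρ
  simp only [← Real.exp_nat_mul] at h ⊢
  exact integral_exp_pos h

lemma integral_norm_psi0_sq :
    ∫ x, ‖psi0 (sphericalMeasure ρ) x‖ ^ 2 ∂sphericalMeasure ρ = 1 := by
  have hN := integral_exp_neg_cosh_sq_pos ρ
  simp only [norm_psi0, mul_pow]
  rw [integral_const_mul, div_pow, Real.sq_sqrt hN.le, one_pow, one_div_mul_cancel hN.ne']

end State

section Tensor

instance : SFinite timeMeasure := inferInstanceAs (SFinite (volume.restrict _))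

lemma differential_eq_onInterval (B : (Chart → ℂ) → Chart → ℂ) {t dt : ℝ} (ht : 0 ≤ t)
    (hdt : 0 ≤ dt) : differential B t dt = onInterval B t dt := by
  ext F s x
  simp only [differential, process, onInterval, smear, Pi.sub_apply, ← sub_mul]
  congr 1
  simp only [indicator_apply, mem_Icc, mem_Ioc, Pi.one_apply]
  grind

lemma inH_tensor {ν : Measure Chart} [SFinite ν] {g : ℝ → ℂ} {φ : Chart → ℂ}
    (hg : MemLp g 2 timeMeasure) (hφ : MemLp φ 2 ν) : InH ν (tensor g φ) := by
  refine (memLp_two_iff_integrable_sq_norm (hg.1.comp_fst.mul hφ.1.comp_snd)).2 ?_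
  simp only [Pi.mul_apply, norm_mul, mul_pow]
  exact (hg.integrable_norm_pow two_ne_zero).mul_prod (hφ.integrable_norm_pow two_ne_zero)

lemma sameVec_tensor {ν : Measure Chart} [SFinite ν] (g : ℝ → ℂ) {φ φ' : Chart → ℂ}
    (h : φ =ᵐ[ν] φ') : SameVec ν (tensor g φ) (tensor g φ') := by
  filter_upwards [Measure.quasiMeasurePreserving_snd.ae h] with p hp
  simp only [tensor, hp]

lemma innerH_tensor (ν : Measure Chart) [SFinite ν] (f g : ℝ → ℂ) (ψ φ : Chart → ℂ) :
    innerH ν (tensor f ψ) (tensor g φ)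
      = (∫ s, conj (f s) * g s ∂timeMeasure) * ∫ x, conj (ψ x) * φ x ∂ν := by
  rw [innerH, ← integral_prod_mul]
  congr with p
  simp only [tensor, map_mul]
  ring

/-- `X` maps every vector `ψ(g) = g ⊗ ψ` to `φ(χ_I g)`. All the operators occurring in the
multiplication rules act on `ψ₀(g)` in this way, so that the rules reduce to identities in `V₃`. -/
def MapsTensor (X : Op) (I : Set ℝ) (ψ φ : Chart → ℂ) : Prop :=
  ∀ g, X (tensor g ψ) = tensor (I.indicator g) φ

namespace MapsTensor

variable {X Y : Op} {I J : Set ℝ} {ψ φ φ' χ : Chart → ℂ}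

lemma comp (hX : MapsTensor X I φ χ) (hY : MapsTensor Y J ψ φ) :
    MapsTensor (X ∘ Y) (I ∩ J) ψ χ := fun g => by
  rw [Function.comp_apply, hY, hX, indicator_indicator]

lemma neg (hX : MapsTensor X I ψ φ) : MapsTensor (-X) I ψ (-φ) := fun g => by
  ext s x
  simp only [Pi.neg_apply, hX g, tensor, mul_neg]

lemma sub (hX : MapsTensor X I ψ φ) (hY : MapsTensor Y I ψ φ') :
    MapsTensor (X - Y) I ψ (φ - φ') := fun g => by
  ext s x
  simp only [Pi.sub_apply, hX g, hY g, tensor, mul_sub]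

lemma smul (c : ℂ) (hX : MapsTensor X I ψ φ) : MapsTensor (c • X) I ψ (c • φ) := fun g => by
  ext s x
  simp only [Pi.smul_apply, hX g, tensor, smul_eq_mul, mul_left_comm]

lemma zero (I : Set ℝ) (ψ : Chart → ℂ) : MapsTensor 0 I ψ 0 := fun _ => by
  ext
  exact (mul_zero _).symm

lemma of_smear {B : (Chart → ℂ) → Chart → ℂ} (hB : IsHomogeneous B) (I : Set ℝ) (ψ : Chart → ℂ) :
    MapsTensor (smear B (I.indicator 1)) I ψ (B ψ) := fun g => by
  ext s x
  calc I.indicator 1 s * B (tensor g ψ s) x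
      = I.indicator 1 s * (g s * B ψ x) := by
        rw [show B (tensor g ψ s) = g s • B ψ from hB (g s) ψ, Pi.smul_apply, smul_eq_mul]
    _ = I.indicator g s * B ψ x := by by_cases hs : s ∈ I <;> simp [hs]

lemma of_onInterval {B : (Chart → ℂ) → Chart → ℂ} (hB : IsHomogeneous B) (t dt : ℝ)
    (ψ : Chart → ℂ) : MapsTensor (onInterval B t dt) (Ioc t (t + dt)) ψ (B ψ) :=
  of_smear hB _ ψ

lemma of_differential {B : (Chart → ℂ) → Chart → ℂ} (hB : IsHomogeneous B) {t dt : ℝ} (ht : 0 ≤ t)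
    (hdt : 0 ≤ dt) (ψ : Chart → ℂ) :
    MapsTensor (differential B t dt) (Ioc t (t + dt)) ψ (B ψ) := by
  rw [differential_eq_onInterval B ht hdt]
  exact of_onInterval hB t dt ψ

lemma of_differential_comp {A B : (Chart → ℂ) → Chart → ℂ} (hA : IsHomogeneous A)
    (hB : IsHomogeneous B) {t dt : ℝ} (ht : 0 ≤ t) (hdt : 0 ≤ dt) (ψ : Chart → ℂ) :
    MapsTensor (differential A t dt ∘ differential B t dt)
      (Ioc t (t + dt)) ψ (A (B ψ)) := by
  simpa only [inter_self] using
    (of_differential hA ht hdt (B ψ)).comp (of_differential hB ht hdt ψ)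

variable {ν : Measure Chart} [SFinite ν]

lemma inH {g : ℝ → ℂ} (hX : MapsTensor X I ψ φ) (hI : MeasurableSet I) (hφ : MemLp φ 2 ν)
    (hg : MemLp g 2 timeMeasure) : InH ν (X (tensor g ψ)) := by
  rw [hX]
  exact inH_tensor (hg.indicator hI) hφ

lemma eqOnState (hX : MapsTensor X I (psi0 ν) φ) (hY : MapsTensor Y I (psi0 ν) φ')
    (hI : MeasurableSet I) (hφ' : MemLp φ' 2 ν) (h : φ =ᵐ[ν] φ') : EqOnState ν X Y :=
  fun g hg => ⟨hX.inH hI (hφ'.ae_eq h.symm) hg, hY.inH hI hφ' hg, by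
    rw [hX, hY]
    exact sameVec_tensor _ h⟩

lemma eqInExpectation (hX : MapsTensor X I (psi0 ν) φ) (hY : MapsTensor Y I (psi0 ν) φ')
    (hI : MeasurableSet I) (hφ : MemLp φ 2 ν) (hφ' : MemLp φ' 2 ν)
    (h : ∫ x, conj (psi0 ν x) * φ x ∂ν = ∫ x, conj (psi0 ν x) * φ' x ∂ν) :
    EqInExpectation ν X Y :=
  fun f g _ hg => ⟨hX.inH hI hφ hg, hY.inH hI hφ' hg, by
    rw [hX, hY, innerH_tensor, innerH_tensor, h]⟩

end MapsTensor

lemma EqOnState.eqInExpectation {ν : Measure Chart} {X Y : Op} (h : EqOnState ν X Y) :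
    EqInExpectation ν X Y := fun f g _ hg => by
  obtain ⟨hX, hY, same⟩ := h g hg
  refine ⟨hX, hY, integral_congr_ae ?_⟩
  filter_upwards [same] with p hp
  rw [hp]

lemma inH_differential {B : (Chart → ℂ) → Chart → ℂ} (hB : IsHomogeneous B) {t dt : ℝ} (ht : 0 ≤ t)
    (hdt : 0 ≤ dt) {ν : Measure Chart} [SFinite ν] {ψ : Chart → ℂ} (hψ : MemLp (B ψ) 2 ν)
    {g : ℝ → ℂ} (hg : MemLp g 2 timeMeasure) : InH ν (differential B t dt (tensor g ψ)) :=
  (MapsTensor.of_differential hB ht hdt ψ).inH measurableSet_Ioc hψ hg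

end Tensor

section MultiplicationRules

lemma mapsTensor_half_smul_onInterval_sub (ν : Measure Chart) (t dt : ℝ) (i : Fin 3) :
    MapsTensor ((1 / 2 : ℂ) • (onInterval (opAminus i) t dt - onInterval (opAplus i) t dt))
      (Ioc t (t + dt)) (psi0 ν) ((Complex.I / (Real.sqrt 2 : ℂ)) • opP i (psi0 ν)) := by
  rw [← half_smul_opAminus_sub_opAplus]
  exact ((MapsTensor.of_onInterval (isHomogeneous_opAminus i) t dt _).sub
    (MapsTensor.of_onInterval (isHomogeneous_opAplus i) t dt _)).smul _

variable (ρ : Measure ℝ)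

variable [IsAdmissibleRadial ρ] {t dt : ℝ} (ht : 0 ≤ t) (hdt : 0 ≤ dt) (i j : Fin 3)

include ht hdt

lemma eqOnState_opAminus_opAplus :
    EqOnState (sphericalMeasure ρ) (differential (opAminus i) t dt ∘ differential (opAplus j) t dt)
      ((if i = j then (1 : ℂ) else 0) • onInterval opJ t dt) := by
  have lhs := MapsTensor.of_differential_comp (isHomogeneous_opAminus i) (isHomogeneous_opAplus j)
    ht hdt (psi0 (sphericalMeasure ρ))
  have rhs := (MapsTensor.of_onInterval isHomogeneous_opJ t dt (psi0 (sphericalMeasure ρ))).smul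
    (if i = j then (1 : ℂ) else 0)
  refine lhs.eqOnState rhs measurableSet_Ioc ((memLp_opJ_psi0 ρ).const_smul _) ?_
  filter_upwards [ae_sinh_ne_zero_and_sin_ne_zero ρ] with x ⟨hsinh, hsin⟩
  exact opAminus_opAplus_psi0 _ i j hsinh hsin

lemma eqOnState_opAplus_opAminus :
    EqOnState (sphericalMeasure ρ)
      (differential (opAplus i) t dt ∘ differential (opAminus j) t dt) 0 := by
  have lhs := MapsTensor.of_differential_comp (isHomogeneous_opAplus i) (isHomogeneous_opAminus j)
    ht hdt (psi0 (sphericalMeasure ρ))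
  refine lhs.eqOnState (.zero _ _) measurableSet_Ioc MemLp.zero (.of_forall fun x => ?_)
  rw [opAminus_psi0, (isHomogeneous_opAplus i).map_zero]

lemma eqOnState_opAminus_opJ :
    EqOnState (sphericalMeasure ρ) (differential (opAminus i) t dt ∘ differential opJ t dt)
      ((1 / 2 : ℂ) • (onInterval (opAminus i) t dt - onInterval (opAplus i) t dt)) := by
  have lhs := MapsTensor.of_differential_comp (isHomogeneous_opAminus i) isHomogeneous_opJ
    ht hdt (psi0 (sphericalMeasure ρ))
  refine lhs.eqOnState (mapsTensor_half_smul_onInterval_sub _ t dt i) measurableSet_Ioc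
    ((memLp_opP_psi0 ρ i).const_smul _) (.of_forall fun x => ?_)
  rw [opAminus_opJ_psi0]

lemma eqInExpectation_neg_opJ_opAminus :
    EqInExpectation (sphericalMeasure ρ)
      (-(differential opJ t dt ∘ differential (opAminus i) t dt))
      ((1 / 2 : ℂ) • (onInterval (opAminus i) t dt - onInterval (opAplus i) t dt)) := by
  have lhs := (MapsTensor.of_differential_comp isHomogeneous_opJ (isHomogeneous_opAminus i)
    ht hdt (psi0 (sphericalMeasure ρ))).neg
  rw [opAminus_psi0, isHomogeneous_opJ.map_zero, neg_zero] at lhs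
  refine lhs.eqInExpectation (mapsTensor_half_smul_onInterval_sub _ t dt i) measurableSet_Ioc
    MemLp.zero ((memLp_opP_psi0 ρ i).const_smul _) ?_
  rw [integral_conj_psi0_mul_smul_opP_psi0]
  simp only [Pi.zero_apply, mul_zero, integral_zero]

lemma eqInExpectation_neg_opJ_opAplus :
    EqInExpectation (sphericalMeasure ρ)
      (-(differential opJ t dt ∘ differential (opAplus i) t dt))
      ((1 / 2 : ℂ) • (onInterval (opAminus i) t dt - onInterval (opAplus i) t dt)) := by
  have lhs := (MapsTensor.of_differential_comp isHomogeneous_opJ (isHomogeneous_opAplus i)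
    ht hdt (psi0 (sphericalMeasure ρ))).neg
  rw [opAplus_psi0, isHomogeneous_opJ, ← neg_smul] at lhs
  refine lhs.eqInExpectation (mapsTensor_half_smul_onInterval_sub _ t dt i) measurableSet_Ioc
    ((memLp_opJ_opP_psi0 ρ i).const_smul _) ((memLp_opP_psi0 ρ i).const_smul _) ?_
  rw [integral_conj_psi0_mul_smul_opP_psi0, integral_conj_psi0_mul_smul_opJ_opP_psi0]

end MultiplicationRules

end IsoThreeOne

open IsoThreeOne in
theorem mainTheorem3_general (ρ : Measure ℝ) [IsAdmissibleRadial ρ] (ν : Measure Chart)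
    (hν : ν = sphericalMeasure ρ) (t dt : ℝ) (ht : 0 ≤ t) (hdt : 0 ≤ dt) (i j : Fin 3) :
    (MemLp (psi0 ν) 2 ν ∧ ∫ x, ‖psi0 ν x‖ ^ 2 ∂ν = 1) ∧
    (∀ g : ℝ → ℂ, MemLp g 2 timeMeasure →
      InH ν (differential (opAminus i) t dt (tensor g (psi0 ν))) ∧
      InH ν (differential (opAplus i) t dt (tensor g (psi0 ν))) ∧
      InH ν (differential opJ t dt (tensor g (psi0 ν)))) ∧
    EqInExpectation ν
      (differential (opAminus i) t dt ∘ differential (opAplus j) t dt)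
      ((if i = j then (1 : ℂ) else 0) • onInterval opJ t dt) ∧
    EqInExpectation ν
      (differential (opAplus i) t dt ∘ differential (opAminus j) t dt) 0 ∧
    EqInExpectation ν
      (differential (opAminus i) t dt ∘ differential opJ t dt)
      ((1 / 2 : ℂ) • (onInterval (opAminus i) t dt - onInterval (opAplus i) t dt)) ∧
    EqInExpectation ν
      (-(differential opJ t dt ∘ differential (opAminus i) t dt))
      ((1 / 2 : ℂ) • (onInterval (opAminus i) t dt - onInterval (opAplus i) t dt)) ∧
    EqInExpectation ν
      (-(differential opJ t dt ∘ differential (opAplus i) t dt))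
      ((1 / 2 : ℂ) • (onInterval (opAminus i) t dt - onInterval (opAplus i) t dt)) ∧
    EqOnState ν
      (differential (opAminus i) t dt ∘ differential (opAplus j) t dt)
      ((if i = j then (1 : ℂ) else 0) • onInterval opJ t dt) ∧
    EqOnState ν
      (differential (opAplus i) t dt ∘ differential (opAminus j) t dt) 0 ∧
    EqOnState ν
      (differential (opAminus i) t dt ∘ differential opJ t dt)
      ((1 / 2 : ℂ) • (onInterval (opAminus i) t dt - onInterval (opAplus i) t dt)) := by
  subst hν
  have minus_plus := eqOnState_opAminus_opAplus ρ ht hdt i j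
  have plus_minus := eqOnState_opAplus_opAminus ρ ht hdt i j
  have minus_time := eqOnState_opAminus_opJ ρ ht hdt i
  exact ⟨⟨memLp_psi0 ρ, integral_norm_psi0_sq ρ⟩,
    fun g hg =>
      ⟨inH_differential (isHomogeneous_opAminus i) ht hdt (memLp_opAminus_psi0 _ i) hg,
        inH_differential (isHomogeneous_opAplus i) ht hdt (memLp_opAplus_psi0 ρ i) hg,
        inH_differential isHomogeneous_opJ ht hdt (memLp_opJ_psi0 ρ) hg⟩,
    minus_plus.eqInExpectation, plus_minus.eqInExpectation, minus_time.eqInExpectation,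
    eqInExpectation_neg_opJ_opAminus ρ ht hdt i, eqInExpectation_neg_opJ_opAplus ρ ht hdt i,
    minus_plus, plus_minus, minus_time⟩

open IsoThreeOne in
theorem mainTheorem3 (ν : Measure Chart) (hν : ν = coordMeasure ∨ ν = invMeasure)
    (t dt : ℝ) (ht : 0 ≤ t) (hdt : 0 ≤ dt) (i j : Fin 3) :
    -- the state is normalized, and the differentials map `ψ₀(g)` into `H₃`
    (MemLp (psi0 ν) 2 ν ∧ ∫ x, ‖psi0 ν x‖ ^ 2 ∂ν = 1) ∧
    (∀ g : ℝ → ℂ, MemLp g 2 timeMeasure →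
      InH ν (differential (opAminus i) t dt (tensor g (psi0 ν))) ∧
      InH ν (differential (opAplus i) t dt (tensor g (psi0 ν))) ∧
      InH ν (differential opJ t dt (tensor g (psi0 ν)))) ∧
    -- the multiplication rules for expectations in the state `ψ₀`
    EqInExpectation ν
      (differential (opAminus i) t dt ∘ differential (opAplus j) t dt)
      ((if i = j then (1 : ℂ) else 0) • onInterval opJ t dt) ∧
    EqInExpectation ν
      (differential (opAplus i) t dt ∘ differential (opAminus j) t dt) 0 ∧
    EqInExpectation ν
      (differential (opAminus i) t dt ∘ differential opJ t dt)
      ((1 / 2 : ℂ) • (onInterval (opAminus i) t dt - onInterval (opAplus i) t dt)) ∧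
    EqInExpectation ν
      (-(differential opJ t dt ∘ differential (opAminus i) t dt))
      ((1 / 2 : ℂ) • (onInterval (opAminus i) t dt - onInterval (opAplus i) t dt)) ∧
    EqInExpectation ν
      (-(differential opJ t dt ∘ differential (opAplus i) t dt))
      ((1 / 2 : ℂ) • (onInterval (opAminus i) t dt - onInterval (opAplus i) t dt)) ∧
    -- the rules that hold as identities between vectors, applied to `ψ₀(g)`
    EqOnState ν
      (differential (opAminus i) t dt ∘ differential (opAplus j) t dt)
      ((if i = j then (1 : ℂ) else 0) • onInterval opJ t dt) ∧
    EqOnState ν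
      (differential (opAplus i) t dt ∘ differential (opAminus j) t dt) 0 ∧
    EqOnState ν
      (differential (opAminus i) t dt ∘ differential opJ t dt)
      ((1 / 2 : ℂ) • (onInterval (opAminus i) t dt - onInterval (opAplus i) t dt)) := by
  rcases hν with rfl | rfl
  · exact mainTheorem3_general volume _ rfl t dt ht hdt i j
  · exact mainTheorem3_general
      ((volume.restrict (Ioi 0)).withDensity fun m => ENNReal.ofReal (Real.sinh m ^ 2)) _ rfl
      t dt ht hdt i j
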